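/- Let $B$ be a complete Boolean algebra satisfying the countable chain condition (ccc): every set of nonzero pairwise disjoint elements of $B$ is countable. For $a\in B$ let $B\restriction a=\{x\in B: x\le a\}$, a complete Boolean algebra with largest element $a$. A sequence $(a_n)_{n\in\mathbb N}$ in a complete Boolean algebra $A$ converges algebraically to $a\in A$ if there is a decreasing sequence $b_0\ge b_1\ge\cdots$ in $A$ with $\bigwedge_n b_n=\mathbf 0$ and $a_n\mathbin{\triangle} a\le b_n$ for all $n$. The order sequential topology $\tau_s$ on $A$ is the topology whose closed sets are the sets that contain the limit of each of their algebraically convergent sequences. A Maharam submeasure on $A$ is a function $\mu:A\to[0,\infty)$ with $\mu(\mathbf 0)=0$, $\mu(x)\le\mu(y)$ whenever $x\le y$, $\mu(x\vee y)\le\mu(x)+\mu(y)$, and $\lim_n\mu(a_n)=0$ for every decreasing sequence $(a_n)$ with $\bigwedge_n a_n=\mathbf 0$; it is strictly positive if $\mu(x)=0$ only for $x=\mathbf 0$. **Decomposition Theorem.** There are disjoint elements $d,m\in B$ with $d\vee m=\mathbf 1$ such that (i) in the space $(B\restriction d,\tau_s)$ the closure of every nonempty open set is the whole space; (ii) the Boolean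 algebra $B\restriction m$ carries a strictly positive Maharam submeasure. Consequently, at least one of the following holds: (a) there is a nonzero $a\in B$ such that $B\restriction a$ carries a strictly positive Maharam submeasure, and there is a Maharam submeasure on $B$ that is not identically zero; (b) every nonempty open set in $(B,\tau_s)$ is dense. -/

import Mathlib

open Set Filter Topology

namespace BoolSeq

/-- The relative algebra `B ↾ a = {x ∈ B : x ≤ a}`, with the lattice operations (including arbitrary
suprema and infima) of the interval, top element `a`, and complement `x ↦ a \ x`. -/
instance relativeAlgebra {B : Type*} [CompleteBooleanAlgebra B] (a : B) :
    CompleteBooleanAlgebra (Iic a) where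
  __ := (Set.Iic.instCompleteLattice : CompleteLattice (Iic a))
  le_sup_inf x y z := by
    apply Subtype.coe_le_coe.1
    exact le_sup_inf (x := (x : B)) (y := (y : B)) (z := (z : B))
  compl x := ⟨a \ (x : B), sdiff_le⟩
  sdiff x y := ⟨(x : B) \ (y : B), sdiff_le.trans x.2⟩
  himp x y := ⟨(y : B) ⊔ a \ (x : B), sup_le y.2 sdiff_le⟩
  inf_compl_le_bot x := by
    apply Subtype.coe_le_coe.1
    change (x : B) ⊓ (a \ (x : B)) ≤ ⊥
    simp
  top_le_sup_compl x := by
    apply Subtype.coe_le_coe.1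
    change a ≤ (x : B) ⊔ (a \ (x : B))
    simp
  sdiff_eq x y := by
    apply Subtype.ext
    change (x : B) \ (y : B) = (x : B) ⊓ (a \ (y : B))
    have hx : (x : B) ⊓ a = x := inf_eq_left.2 x.2
    rw [← inf_sdiff_assoc, hx]
  himp_eq x y := rfl

section

variable {B : Type*} [CompleteBooleanAlgebra B]

/-- The countable chain condition: every antichain (set of nonzero pairwise disjoint elements)
is countable. -/
def CCC (B : Type*) [CompleteBooleanAlgebra B] : Prop :=
  ∀ A : Set B, (∀ x ∈ A, x ≠ ⊥) → (∀ x ∈ A, ∀ y ∈ A, x ≠ y → x ⊓ y = ⊥) → A.Countable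

/-- Algebraic convergence to zero: `a n ≤ b n` for some decreasing `b` with infimum zero. -/
def ConvergesToZero (a : ℕ → B) : Prop :=
  ∃ b : ℕ → B, Antitone b ∧ ⨅ n, b n = ⊥ ∧ ∀ n, a n ≤ b n

/-- Algebraic convergence to `x`: the symmetric differences with `x` converge to zero. -/
def ConvergesTo (a : ℕ → B) (x : B) : Prop :=
  ConvergesToZero fun n => symmDiff (a n) x

/-- `A` contains the limit of every algebraically convergent sequence of elements of `A`. -/
def SeqClosed (A : Set B) : Prop :=
  ∀ (a : ℕ → B) (x : B), (∀ n, a n ∈ A) → ConvergesTo a x → x ∈ A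

theorem ConvergesTo.subseq {a : ℕ → B} {x : B} (h : ConvergesTo a x) {φ : ℕ → ℕ}
    (hφ : StrictMono φ) : ConvergesTo (a ∘ φ) x := by
  obtain ⟨b, hb, h0, hab⟩ := h
  refine ⟨b, hb, h0, fun n => ?_⟩
  exact (hab (φ n)).trans (hb (hφ.id_le n))

theorem SeqClosed.union {A C : Set B} (hA : SeqClosed A) (hC : SeqClosed C) :
    SeqClosed (A ∪ C) := by
  intro a x ha hx
  by_cases h : ∃ᶠ n in atTop, a n ∈ A
  · obtain ⟨φ, hφ, hm⟩ := Filter.extraction_of_frequently_atTop h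
    exact Or.inl (hA _ x hm (hx.subseq hφ))
  · rw [Filter.not_frequently] at h
    obtain ⟨φ, hφ, hm⟩ := Filter.extraction_of_frequently_atTop h.frequently
    exact Or.inr (hC _ x (fun n => (ha (φ n)).resolve_left (hm n)) (hx.subseq hφ))

/-- The order sequential topology `τ_s`: its closed sets are the sets that are closed under limits
of algebraically convergent sequences. -/
abbrev orderSeqTopology (B : Type*) [CompleteBooleanAlgebra B] : TopologicalSpace B :=
  TopologicalSpace.ofClosed {A : Set B | SeqClosed A}
    (fun _ _ ha _ => (ha 0).elim)
    (fun _ hS a x ha hx => Set.mem_sInter.2 fun A hA =>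
      hS hA a x (fun n => Set.mem_sInter.1 (ha n) A hA) hx)
    (fun _ hA _ hC => SeqClosed.union hA hC)

theorem isClosed_orderSeqTopology_iff (A : Set B) :
    IsClosed[orderSeqTopology B] A ↔ SeqClosed A := by
  rw [← @isOpen_compl_iff _ _ (orderSeqTopology B)]
  change SeqClosed Aᶜᶜ ↔ SeqClosed A
  rw [compl_compl]

/-- The closure of `A` in `τ_s` is the smallest superset of `A` that is closed under limits of
algebraically convergent sequences. -/
theorem isLeast_closure_orderSeqTopology (A : Set B) :
    IsLeast {C : Set B | A ⊆ C ∧ SeqClosed C} (closure[orderSeqTopology B] A) := by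
  let := orderSeqTopology B
  refine ⟨⟨subset_closure, (isClosed_orderSeqTopology_iff _).1 isClosed_closure⟩, ?_⟩
  rintro C ⟨hAC, hC⟩
  exact closure_minimal hAC ((isClosed_orderSeqTopology_iff _).2 hC)

/-- In `(B, τ_s)` the closure of every nonempty open set is the whole space. -/
def EveryNonemptyOpenDense (B : Type*) [CompleteBooleanAlgebra B] : Prop :=
  ∀ U : Set B, IsOpen[orderSeqTopology B] U → U.Nonempty →
    closure[orderSeqTopology B] U = Set.univ

/-- A Maharam submeasure on `B`: a nonnegative real valued monotone subadditive function vanishing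
at zero which is continuous along decreasing sequences with infimum zero. -/
structure IsMaharamSubmeasure (μ : B → ℝ) : Prop where
  nonneg : ∀ x, 0 ≤ μ x
  map_bot : μ ⊥ = 0
  mono : ∀ x y, x ≤ y → μ x ≤ μ y
  map_sup_le : ∀ x y, μ (x ⊔ y) ≤ μ x + μ y
  continuous : ∀ a : ℕ → B, Antitone a → ⨅ n, a n = ⊥ → Tendsto (fun n => μ (a n)) atTop (𝓝 0)

/-- `B` carries a strictly positive Maharam submeasure. -/
def CarriesStrictlyPositiveMaharam (B : Type*) [CompleteBooleanAlgebra B] : Prop :=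
  ∃ μ : B → ℝ, IsMaharamSubmeasure μ ∧ ∀ x, μ x = 0 → x = ⊥

end

end BoolSeq

/-!
The cluster points of the neighborhood filter of `⊥` in `τ_s` form a closed ideal, and by ccc a
closed ideal is principal; let `d` be its largest element. Translating by elements of the ideal,
every nonempty open set is dense in `B ↾ d`, while in `B ↾ dᶜ` only `⊥` is a cluster point, so
`τ_s` is Hausdorff there.

In a Hausdorff ccc algebra the double limits `⨅ k, ⨆ n, b k n` that violate weak distributivity
would be cluster points, hence `τ_s` is Fréchet and `⊥` has a basis of downward closed
neighborhoods. To find a neighborhood whose joins stay in a given one, suppose there is none and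
select bad elements whose upper limits, by ccc, no longer drop along subsequences; this contradicts
the Fréchet property. Iterating gives a sequence `W` of downward closed neighborhoods with
`W (n + 1) ⊻ W (n + 1) ⊆ W n` and, again by ccc, one with intersection `{⊥}`. The relations
`x ∆ y ∈ W n` generate a metrizable uniformity, and how far translations by elements below `x`
move points in its metric is a strictly positive Maharam submeasure of `x`.
-/

open scoped symmDiff SetFamily ENNReal Uniformity

namespace BoolSeq

section Convergence

variable {B : Type*} [CompleteBooleanAlgebra B]

theorem ConvergesToZero.mono {a b : ℕ → B} (hb : ConvergesToZero b) (h : ∀ n, a n ≤ b n) :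
    ConvergesToZero a := by
  obtain ⟨c, hc, hc0, hbc⟩ := hb
  exact ⟨c, hc, hc0, fun n => (h n).trans (hbc n)⟩

theorem ConvergesToZero.sup {a b : ℕ → B} (ha : ConvergesToZero a) (hb : ConvergesToZero b) :
    ConvergesToZero fun n => a n ⊔ b n := by
  obtain ⟨c, hc, hc0, hac⟩ := ha
  obtain ⟨d, hd, hd0, hbd⟩ := hb
  refine ⟨fun n => c n ⊔ d n, hc.sup hd, ?_, fun n => sup_le_sup (hac n) (hbd n)⟩
  rw [iInf_sup_of_antitone hc hd, hc0, hd0, sup_bot_eq]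

theorem convergesToZero_bot : ConvergesToZero fun _ : ℕ => (⊥ : B) :=
  ⟨fun _ => ⊥, antitone_const, iInf_const, fun _ => le_rfl⟩

theorem ConvergesToZero.iSup {ι : Type*} [Finite ι] {a : ι → ℕ → B}
    (ha : ∀ i, ConvergesToZero (a i)) : ConvergesToZero fun n => ⨆ i, a i n := by
  classical
  cases nonempty_fintype ι
  suffices ∀ s : Finset ι, ConvergesToZero fun n => s.sup fun i => a i n by
    simpa only [Finset.sup_univ_eq_iSup] using this Finset.univ
  intro s
  induction s using Finset.induction_on with
  | empty => simpa only [Finset.sup_empty] using convergesToZero_bot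
  | insert i s _ ih => simpa only [Finset.sup_insert] using (ha i).sup ih

theorem convergesToZero_iff_limsup {a : ℕ → B} :
    ConvergesToZero a ↔ limsup a atTop = ⊥ := by
  constructor
  · rintro ⟨b, hb, hb0, hab⟩
    rw [← le_bot_iff, ← hb0]
    refine le_iInf fun n => limsup_le_of_le (h := ?_)
    filter_upwards [eventually_ge_atTop n] with m hm using (hab m).trans (hb hm)
  · rw [limsup_eq_iInf_iSup_of_nat]
    exact fun h => ⟨_, fun _ _ hnm => biSup_mono fun _ => hnm.trans, h,
      fun n => le_iSup₂_of_le n le_rfl le_rfl⟩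

theorem convergesTo_bot_iff {a : ℕ → B} : ConvergesTo a ⊥ ↔ ConvergesToZero a := by
  simp only [ConvergesTo, symmDiff_bot]

theorem convergesTo_iSup_of_monotone {s : ℕ → B} (hs : Monotone s) :
    ConvergesTo s (⨆ n, s n) := by
  refine ⟨fun n => (⨆ k, s k) \ s n, fun _ _ h => sdiff_le_sdiff_left (hs h), ?_, fun n => ?_⟩
  · simp only [_root_.sdiff_eq, ← inf_iInf, ← compl_iSup, inf_compl_self]
  · exact (symmDiff_of_le (le_iSup s n)).le

end Convergence

section CountableChainCondition

variable {B : Type*} [CompleteBooleanAlgebra B]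

theorem CCC.countable_of_pairwise_disjoint (hB : CCC B) {ι : Type*} {f : ι → B}
    (hf : Pairwise (Function.onFun Disjoint f)) : {i | f i ≠ ⊥}.Countable := by
  have inj : InjOn f {i | f i ≠ ⊥} := fun i hi j _ hij => by
    by_contra hne
    exact hi ((hf hne).eq_bot_of_le hij.le)
  refine countable_of_injective_of_countable_image inj (hB _ ?_ ?_)
  · rintro _ ⟨i, hi, rfl⟩
    exact hi
  · rintro _ ⟨i, _, rfl⟩ _ ⟨j, _, rfl⟩ hne
    exact (hf fun h => hne (congrArg f h)).eq_bot

theorem CCC.exists_nat_iSup_eq (hB : CCC B) {ι : Type*} [Nonempty ι] (f : ι → B) :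
    ∃ t : ℕ → ι, ⨆ n, f (t n) = ⨆ i, f i := by
  -- Disjointifying `f` along a well-order of `ι` leaves only countably many nonzero pieces.
  obtain ⟨_, _⟩ := exists_wellFoundedLT ι
  let d : ι → B := fun i => f i \ ⨆ j < i, f j
  have disjoint_of_lt {i j : ι} (hij : i < j) : Disjoint (d i) (d j) :=
    disjoint_sdiff_self_right.mono_left (sdiff_le.trans (le_iSup₂_of_le i hij le_rfl))
  have countable : {i | d i ≠ ⊥}.Countable := hB.countable_of_pairwise_disjoint fun i j hne =>
    hne.lt_or_gt.elim disjoint_of_lt fun h => (disjoint_of_lt h).symm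
  obtain ⟨t, ht⟩ :=
    (countable.insert (Classical.arbitrary ι)).exists_eq_range (insert_nonempty _ _)
  refine ⟨t, le_antisymm (iSup_le fun n => le_iSup f _) (iSup_le fun i => ?_)⟩
  induction i using WellFoundedLT.induction with
  | ind i ih =>
    by_cases hi : d i = ⊥
    · exact (sdiff_eq_bot_iff.1 hi).trans (iSup₂_le ih)
    · obtain ⟨n, rfl⟩ : i ∈ range t := ht ▸ mem_insert_of_mem _ hi
      exact le_iSup (fun n => f (t n)) n

theorem CCC.exists_nat_iInf_eq (hB : CCC B) {ι : Type*} [Nonempty ι] (f : ι → B) :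
    ∃ t : ℕ → ι, ⨅ n, f (t n) = ⨅ i, f i := by
  obtain ⟨t, ht⟩ := hB.exists_nat_iSup_eq fun i => (f i)ᶜ
  exact ⟨t, compl_injective (by simpa only [compl_iInf] using ht)⟩

theorem CCC.bddBelow_of_isChain (hB : CCC B) {P : Type*} [Preorder P]
    (bddBelow_range : ∀ u : ℕ → P, Antitone u → BddBelow (range u)) {L : P → B} {M : Set P}
    (hM : IsChain (fun p q => p ≤ q ∧ L p < L q) M) (hne : M.Nonempty) : BddBelow M := by
  -- By ccc, countably many members of `M` realize the infimum of `L` on `M`; as `L` is strictly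
  -- monotone on `M`, they are coinitial in `M`.
  have := hne.to_subtype
  by_cases h_least : ∃ p ∈ M, ∀ q ∈ M, p ≤ q
  · obtain ⟨p, -, hp⟩ := h_least
    exact ⟨p, hp⟩
  push Not at h_least
  have exists_lt (p : M) : ∃ q : M, (q : P) ≤ p ∧ L q < L p := by
    obtain ⟨q, hq, hpq⟩ := h_least p p.2
    obtain h | h := hM p.2 hq fun h => hpq h.le
    · exact (hpq h.1).elim
    · exact ⟨⟨q, hq⟩, h⟩
  obtain ⟨t, ht⟩ := hB.exists_nat_iInf_eq fun p : M => L p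
  have exists_le (p : M) : ∃ n, (t n : P) ≤ p := by
    by_contra! h
    obtain ⟨q, -, hq⟩ := exists_lt p
    refine hq.not_ge (le_trans ?_ (iInf_le (fun p : M => L p) q))
    refine ht ▸ le_iInf fun n => ?_
    obtain hn | hn := hM (t n).2 p.2 fun hn => h n hn.le
    · exact (h n hn.1).elim
    · exact hn.2.le
  have directed : Directed (· ≥ ·) fun n => (t n : P) := by
    intro m n
    obtain hmn | hmn := eq_or_ne (t m : P) (t n)
    · exact ⟨m, le_rfl, hmn.le⟩
    · obtain h | h := hM (t m).2 (t n).2 hmn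
      · exact ⟨m, le_rfl, h.1⟩
      · exact ⟨n, h.1, le_rfl⟩
  obtain ⟨b, hb⟩ := bddBelow_range _ directed.sequence_anti
  refine ⟨b, fun p hp => ?_⟩
  obtain ⟨n, hn⟩ := exists_le ⟨p, hp⟩
  exact (hb (mem_range_self _)).trans ((directed.sequence_le n).trans hn)

theorem CCC.exists_le_forall_le_eq (hB : CCC B) {P : Type*} [Preorder P]
    (bddBelow_range : ∀ u : ℕ → P, Antitone u → BddBelow (range u)) {L : P → B} (hL : Monotone L)
    (p₀ : P) : ∃ p ≤ p₀, ∀ q ≤ p, L q = L p := by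
  obtain ⟨M, hM, hp₀⟩ :=
    (IsChain.singleton (r := fun p q : P => p ≤ q ∧ L p < L q) (a := p₀)).exists_maxChain
  rw [singleton_subset_iff] at hp₀
  obtain ⟨b, hb⟩ := hB.bddBelow_of_isChain bddBelow_range hM.isChain ⟨p₀, hp₀⟩
  refine ⟨b, hb hp₀, fun q hq => eq_of_le_of_not_lt (hL hq) fun hlt => ?_⟩
  have lt_of_mem {p : P} (hp : p ∈ M) : q ≤ p ∧ L q < L p :=
    ⟨hq.trans (hb hp), hlt.trans_le (hL (hb hp))⟩
  have hqM : insert q M = M :=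
    (hM.2 (hM.isChain.insert fun p hp _ => Or.inl (lt_of_mem hp)) (subset_insert q M)).symm
  exact (lt_of_mem (hqM ▸ mem_insert q M)).2.false

theorem CCC.exists_le_forall_le_eq_of_finite (hB : CCC B) {P ι : Type*} [Preorder P] [Finite ι]
    (bddBelow_range : ∀ u : ℕ → P, Antitone u → BddBelow (range u)) {L : ι → P → B}
    (hL : ∀ i, Monotone (L i)) (p₀ : P) : ∃ p ≤ p₀, ∀ i, ∀ q ≤ p, L i q = L i p := by
  classical
  cases nonempty_fintype ι
  suffices ∀ s : Finset ι, ∃ p ≤ p₀, ∀ i ∈ s, ∀ q ≤ p, L i q = L i p by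
    simpa only [Finset.mem_univ, true_imp_iff] using this Finset.univ
  intro s
  induction s using Finset.induction_on with
  | empty => exact ⟨p₀, le_rfl, by simp⟩
  | insert i s _ ih =>
    obtain ⟨p, hp, hps⟩ := ih
    obtain ⟨p', hp', hpi⟩ := hB.exists_le_forall_le_eq bddBelow_range (hL i) p
    refine ⟨p', hp'.trans hp, (Finset.forall_mem_insert ..).2 ⟨hpi, fun j hj q hq => ?_⟩⟩
    rw [hps j hj q (hq.trans hp'), hps j hj p' hp']

theorem CCC.exists_filter_forall_limsup_eq (hB : CCC B) {α ι : Type*} [Finite ι]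
    (x : ι → α → B) (F₀ : Filter α) [F₀.NeBot] [F₀.IsCountablyGenerated] :
    ∃ F ≤ F₀, F.NeBot ∧ F.IsCountablyGenerated ∧
      ∀ i, ∀ G ≤ F, G.NeBot → G.IsCountablyGenerated → limsup (x i) G = limsup (x i) F := by
  let P := {F : Filter α // F.NeBot ∧ F.IsCountablyGenerated}
  have bddBelow_range (u : ℕ → P) (hu : Antitone u) : BddBelow (range u) := by
    have (n : ℕ) := (u n).2.2
    have hne : (⨅ n, (u n : Filter α)).NeBot :=
      iInf_neBot_of_directed' (Antitone.directed_ge fun _ _ h => hu h) fun n => (u n).2.1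
    refine ⟨⟨⨅ n, (u n : Filter α), hne, inferInstance⟩, ?_⟩
    rintro _ ⟨n, rfl⟩
    exact iInf_le (fun n => (u n : Filter α)) n
  obtain ⟨F, hF, hFx⟩ := hB.exists_le_forall_le_eq_of_finite bddBelow_range
    (L := fun i (F : P) => limsup (x i) F) (fun i _ _ h => limsup_le_limsup_of_le h)
    ⟨F₀, ‹_›, ‹_›⟩
  exact ⟨F, hF, F.2.1, F.2.2, fun i G hG h h' => hFx i ⟨G, h, h'⟩ hG⟩

theorem CCC.exists_selection (hB : CCC B) {ι : Type*} [Finite ι] [Nonempty ι]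
    (v : ℕ → ι → B) : ∃ (t : ℕ → ι) (φ : ℕ → ℕ), StrictMono φ ∧
      ConvergesToZero fun n => (⨆ i, v (φ n) i) \ ⨆ k, v k (t k) := by
  -- Pass to a sequence `φ` along which no `limsup` of a column of `v` drops on a subsequence, and
  -- cut `φ` into infinitely many terms for each column.
  obtain ⟨F, hF, _, _, hFv⟩ := hB.exists_filter_forall_limsup_eq (fun i n => v n i) atTop
  obtain ⟨u, hu⟩ := F.exists_seq_tendsto
  obtain ⟨ψ, hψ, hφ⟩ := strictMono_subseq_of_tendsto_atTop (hu.mono_right hF)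
  set φ := u ∘ ψ
  have hφF : Tendsto φ atTop F := hu.comp hψ.tendsto_atTop
  obtain ⟨e⟩ := nonempty_equiv_of_countable (α := ℕ) (β := ι × ℕ)
  let t : ℕ → ι := Function.extend φ (fun m => (e m).1) fun _ => Classical.arbitrary ι
  have t_apply (i : ι) (j : ℕ) : t (φ (e.symm (i, j))) = i := by
    simp only [t, hφ.injective.extend_apply, e.apply_symm_apply]
  have limsup_le (i : ι) : limsup (fun n => v (φ n) i) atTop ≤ ⨆ k, v k (t k) := by
    have tendsto_column : Tendsto (fun j => φ (e.symm (i, j))) atTop F :=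
      hφF.comp (e.symm.injective.comp (Prod.mk_right_injective i)).nat_tendsto_atTop
    calc limsup (fun n => v (φ n) i) atTop
      _ = limsup (fun n => v n i) F := hFv i _ hφF inferInstance inferInstance
      _ = limsup (fun j => v (φ (e.symm (i, j))) i) atTop :=
        (hFv i _ tendsto_column inferInstance inferInstance).symm
      _ ≤ ⨆ k, v k (t k) := limsup_le_of_le (h := Eventually.of_forall fun j => by
        simpa only [t_apply] using le_iSup (fun k => v k (t k)) (φ (e.symm (i, j))))
  refine ⟨t, φ, hφ, ?_⟩
  simp only [iSup_sdiff_eq]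
  refine ConvergesToZero.iSup fun i => convergesToZero_iff_limsup.2 ?_
  rw [← limsup_sdiff, sdiff_eq_bot_iff]
  exact limsup_le i

end CountableChainCondition

theorem exists_pseudoMetricSpace_hasBasis_uniformity {X : Type*} {E : ℕ → SetRel X X}
    (refl : ∀ n x, (x, x) ∈ E n) (symm : ∀ n x y, (x, y) ∈ E n → (y, x) ∈ E n)
    (comp : ∀ n x y z, (x, y) ∈ E (n + 1) → (y, z) ∈ E (n + 1) → (x, z) ∈ E n) :
    ∃ _ : PseudoMetricSpace X, (𝓤 X).HasBasis (fun _ : ℕ => True) E := by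
  have antitone : Antitone E :=
    antitone_nat_of_succ_le fun n ⟨x, y⟩ h => comp n x y y h (refl _ y)
  let basis : FilterBasis (X × X) :=
    { sets := range E
      nonempty := range_nonempty E
      inter_sets := by
        rintro _ _ ⟨m, rfl⟩ ⟨n, rfl⟩
        exact ⟨_, mem_range_self (max m n),
          subset_inter (antitone (le_max_left m n)) (antitone (le_max_right m n))⟩ }
  let _ : UniformSpace X := .ofCore <| .mkOfBasis basis
    (forall_mem_range.2 refl)
    (forall_mem_range.2 fun n => ⟨_, mem_range_self n, fun p => symm n p.1 p.2⟩)
    (forall_mem_range.2 fun n => ⟨_, mem_range_self (n + 1), fun p ⟨y, h, h'⟩ =>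
      comp n p.1 y p.2 h h'⟩)
  have hasBasis : (𝓤 X).HasBasis (fun _ : ℕ => True) E :=
    basis.hasBasis.to_hasBasis (forall_mem_range.2 fun n => ⟨n, trivial, subset_rfl⟩)
      fun n _ => ⟨E n, mem_range_self n, subset_rfl⟩
  have := hasBasis.isCountablyGenerated
  exact ⟨UniformSpace.pseudoMetricSpace X, hasBasis⟩

section Displacement

variable {B : Type*} [GeneralizedBooleanAlgebra B] [PseudoEMetricSpace B]

/-- The largest distance by which translation by an element `z ≤ x` moves a point of `B`, seen as a
group under symmetric difference. It turns a metric into a monotone subadditive function. -/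
noncomputable def displacement (x : B) : ℝ≥0∞ :=
  ⨆ y : B, ⨆ z ≤ x, edist y (y ∆ z)

theorem edist_symmDiff_le_displacement {x z : B} (hz : z ≤ x) (y : B) :
    edist y (y ∆ z) ≤ displacement x :=
  le_iSup_of_le y (le_iSup₂_of_le z hz le_rfl)

theorem displacement_le_iff {x : B} {r : ℝ≥0∞} :
    displacement x ≤ r ↔ ∀ y, ∀ z ≤ x, edist y (y ∆ z) ≤ r := by
  simp only [displacement, iSup_le_iff]

theorem displacement_bot : displacement (⊥ : B) = 0 := by
  refine le_bot_iff.1 (displacement_le_iff.2 fun y z hz => ?_)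
  rw [le_bot_iff.1 hz, symmDiff_bot, edist_self, bot_eq_zero]

theorem displacement_mono : Monotone (displacement : B → ℝ≥0∞) := fun _ _ hxy =>
  displacement_le_iff.2 fun y _ hz => edist_symmDiff_le_displacement (hz.trans hxy) y

theorem displacement_sup_le (x x' : B) :
    displacement (x ⊔ x') ≤ displacement x + displacement x' := by
  refine displacement_le_iff.2 fun y z hz => ?_
  have hz' : z \ x ≤ x' := sdiff_le_iff.2 hz
  have symmDiff_eq : y ∆ (z ⊓ x) ∆ (z \ x) = y ∆ z := by
    rw [symmDiff_assoc, (disjoint_inf_sdiff (x := z) (y := x)).symmDiff_eq_sup, sup_inf_sdiff]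
  calc edist y (y ∆ z)
    _ ≤ edist y (y ∆ (z ⊓ x)) + edist (y ∆ (z ⊓ x)) (y ∆ (z ⊓ x) ∆ (z \ x)) :=
      symmDiff_eq ▸ edist_triangle _ _ _
    _ ≤ displacement x + displacement x' :=
      add_le_add (edist_symmDiff_le_displacement inf_le_right y)
        (edist_symmDiff_le_displacement hz' _)

theorem edist_bot_le_displacement (x : B) : edist ⊥ x ≤ displacement x := by
  simpa only [bot_symmDiff] using edist_symmDiff_le_displacement (le_refl x) ⊥

end Displacement

theorem isMaharamSubmeasure_toReal_min_one {B : Type*} [CompleteBooleanAlgebra B] {ν : B → ℝ≥0∞}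
    (map_bot : ν ⊥ = 0) (mono : Monotone ν) (map_sup_le : ∀ x y, ν (x ⊔ y) ≤ ν x + ν y)
    (tendsto : ∀ a : ℕ → B, Antitone a → ⨅ n, a n = ⊥ → Tendsto (fun n => ν (a n)) atTop (𝓝 0)) :
    IsMaharamSubmeasure fun x => (min 1 (ν x)).toReal where
  nonneg _ := ENNReal.toReal_nonneg
  map_bot := by simp [map_bot]
  mono x y hxy := by
    have := mono hxy
    gcongr
    simp
  map_sup_le x y := by
    rw [← ENNReal.toReal_add (by simp) (by simp)]
    gcongr
    · simp
    calc min 1 (ν (x ⊔ y)) ≤ min 1 (ν x + ν y) := min_le_min_left 1 (map_sup_le x y)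
      _ ≤ min 1 (ν x) + min 1 (ν y) :=
        min_add_distrib (1 : ℝ≥0∞) _ _ ▸ min_le_right _ _
  continuous a ha ha0 := by
    have h : Tendsto (fun n => min 1 (ν (a n))) atTop (𝓝 (min 1 0)) :=
      tendsto_const_nhds.min (tendsto a ha ha0)
    simpa [Function.comp_def] using (ENNReal.tendsto_toReal (by simp)).comp h

section Topology

attribute [local instance] orderSeqTopology

variable {B : Type*} [CompleteBooleanAlgebra B]

theorem ConvergesTo.tendsto {a : ℕ → B} {x : B} (h : ConvergesTo a x) :
    Tendsto a atTop (𝓝 x) := by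
  refine tendsto_nhds.2 fun U hU hxU => not_not.1 fun h_not => ?_
  obtain ⟨φ, hφ, ha⟩ := extraction_of_frequently_atTop (not_eventually.1 h_not)
  exact (isClosed_orderSeqTopology_iff Uᶜ).1 hU.isClosed_compl _ x ha (h.subseq hφ) hxU

theorem continuous_of_convergesTo {C : Type*} [CompleteBooleanAlgebra C] {f : B → C}
    (hf : ∀ a x, ConvergesTo a x → ConvergesTo (fun n => f (a n)) (f x)) : Continuous f :=
  continuous_iff_isClosed.2 fun A hA => (isClosed_orderSeqTopology_iff _).2 fun a x ha hax =>
    (isClosed_orderSeqTopology_iff A).1 hA _ _ ha (hf a x hax)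

theorem continuous_of_symmDiff_le {f : B → B} (hf : ∀ x y, f x ∆ f y ≤ x ∆ y) : Continuous f :=
  continuous_of_convergesTo fun a x h => ConvergesToZero.mono h fun n => hf (a n) x

theorem continuous_inf_const (c : B) : Continuous fun x : B => x ⊓ c :=
  continuous_of_symmDiff_le fun x y =>
    (inf_symmDiff_distrib_right x y c).symm.trans_le inf_le_left

theorem symmDiff_sup_sup_le (x y c : B) : (x ⊔ c) ∆ (y ⊔ c) ≤ x ∆ y := by
  rw [← compl_symmDiff_compl, compl_sup, compl_sup, ← inf_symmDiff_distrib_right,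
    compl_symmDiff_compl]
  exact inf_le_left

theorem continuous_sup_const (c : B) : Continuous fun x : B => x ⊔ c :=
  continuous_of_symmDiff_le fun x y => symmDiff_sup_sup_le x y c

theorem continuous_symmDiff_const (c : B) : Continuous fun x : B => x ∆ c :=
  continuous_of_symmDiff_le fun x y => by
    rw [symmDiff_symmDiff_symmDiff_comm, symmDiff_self, symmDiff_bot]

theorem tendsto_partialSups (s : ℕ → B) : Tendsto (partialSups s) atTop (𝓝 (⨆ n, s n)) :=
  iSup_partialSups_eq s ▸ (convergesTo_iSup_of_monotone (partialSups s).monotone).tendsto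

theorem CCC.sSup_mem_of_isClosed (hB : CCC B) {S : Set B} (hS : IsClosed S) (hne : S.Nonempty)
    (hsup : SupClosed S) : sSup S ∈ S := by
  have := hne.to_subtype
  obtain ⟨t, ht⟩ := hB.exists_nat_iSup_eq fun s : S => (s : B)
  rw [sSup_eq_iSup', ← ht]
  refine hS.mem_of_tendsto (tendsto_partialSups _) (Eventually.of_forall fun n => ?_)
  rw [partialSups_apply]
  exact hsup.finsetSup'_mem _ fun k _ => (t k).2

section ClusterPoints

theorem clusterPt_nhds_map {X Y : Type*} {_ : TopologicalSpace X} {_ : TopologicalSpace Y}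
    {f : X → Y} (hf : Continuous f) {x y : X} (h : ClusterPt x (𝓝 y)) : ClusterPt (f x) (𝓝 (f y)) :=
  h.map hf.continuousAt hf.continuousAt

theorem clusterPt_nhds_bot_of_le {x y : B} (hx : ClusterPt x (𝓝 ⊥)) (hyx : y ≤ x) :
    ClusterPt y (𝓝 ⊥) := by
  simpa only [inf_eq_right.2 hyx, bot_inf_eq] using clusterPt_nhds_map (continuous_inf_const y) hx

theorem symmDiff_mem_closure {U : Set B} (hU : IsOpen U) {x y : B} (hx : x ∈ closure U)
    (hy : ClusterPt y (𝓝 ⊥)) : x ∆ y ∈ closure U := by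
  suffices MapsTo (· ∆ y) U (closure U) by
    simpa only [closure_closure] using this.closure (continuous_symmDiff_const y) hx
  intro u hu
  have h : ClusterPt (u ∆ y) (𝓝 u) := by
    simpa only [bot_symmDiff, symmDiff_comm y] using
      clusterPt_nhds_map (continuous_symmDiff_const u) hy
  exact h.mem_closure_of_mem _ (hU.mem_nhds hu)

theorem supClosed_clusterPt_nhds_bot : SupClosed {x : B | ClusterPt x (𝓝 ⊥)} := by
  intro x hx y hy
  refine (nhds_basis_opens _).clusterPt_iff_forall_mem_closure.2 fun U ⟨hbot, hU⟩ => ?_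
  have h := symmDiff_mem_closure hU (ClusterPt.mem_closure_of_mem hx _ (hU.mem_nhds hbot))
    (clusterPt_nhds_bot_of_le hy (sdiff_le : y \ x ≤ y))
  rwa [symmDiff_sdiff_eq_sup] at h

theorem everyNonemptyOpenDense_of_clusterPt_top (h : ClusterPt (⊤ : B) (𝓝 ⊥)) :
    EveryNonemptyOpenDense B := by
  rintro U hU ⟨u, hu⟩
  refine eq_univ_of_forall fun x => ?_
  simpa only [symmDiff_symmDiff_cancel_left] using
    symmDiff_mem_closure hU (subset_closure hu) (clusterPt_nhds_bot_of_le h (le_top (a := u ∆ x)))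

theorem t2Space_of_forall_clusterPt (h : ∀ x : B, ClusterPt x (𝓝 ⊥) → x = ⊥) : T2Space B := by
  refine t2_iff_nhds.2 fun {x y} hxy => symmDiff_eq_bot.1 (h _ ?_)
  simpa only [symmDiff_self] using clusterPt_nhds_map (continuous_symmDiff_const y) hxy

/-- The largest element of `B` that `τ_s` cannot separate from `⊥`, which is such an element if
`B` is ccc: the part `d` of the decomposition. -/
noncomputable def densePart (B : Type*) [CompleteBooleanAlgebra B] : B :=
  sSup {x | ClusterPt x (𝓝 ⊥)}

theorem CCC.clusterPt_densePart (hB : CCC B) : ClusterPt (densePart B) (𝓝 ⊥) :=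
  hB.sSup_mem_of_isClosed isClosed_setOfPred_clusterPt ⟨⊥, ClusterPt.of_nhds_le le_rfl⟩
    supClosed_clusterPt_nhds_bot

end ClusterPoints

theorem exists_forall_iSup_mem_closure {ι : Type*} [Finite ι] {U : Set B} (hU : IsOpen U)
    (hbot : ⊥ ∈ U) {p : ℕ → (ι → B) → Prop}
    (hp : ∀ n, ∀ V ∈ 𝓝 (⊥ : B), ∃ v : ι → B, (∀ i, v i ∈ V) ∧ p n v) :
    ∃ v : ℕ → ι → B, (∀ n, p n (v n)) ∧ ∀ t : ℕ → ι, ⨆ n, v n (t n) ∈ closure U := by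
  -- The state `S n` holds the joins of the first `n` choices: finitely many, so that small enough
  -- next choices keep all of them in `U`.
  let State := {S : Set B // S.Finite ∧ S ⊆ U}
  have exists_step (n : ℕ) (S : State) : ∃ v : ι → B, p n v ∧ S.1 ⊻ range v ⊆ U := by
    have hV : ⋂ s ∈ S.1, (· ⊔ s) ⁻¹' U ∈ 𝓝 ⊥ := (biInter_mem S.2.1).2 fun s hs =>
      (hU.preimage (continuous_sup_const s)).mem_nhds (by simpa using S.2.2 hs)
    obtain ⟨v, hv, hpv⟩ := hp n _ hV
    refine ⟨v, hpv, sups_subset_iff.2 fun s hs => forall_mem_range.2 fun i => ?_⟩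
    exact sup_comm (v i) s ▸ mem_iInter₂.1 (hv i) s hs
  choose next p_next next_subset using exists_step
  let S (n : ℕ) : State := n.rec ⟨{⊥}, finite_singleton ⊥, singleton_subset_iff.2 hbot⟩
    fun k T => ⟨T.1 ⊻ range (next k T), T.2.1.image2 _ (finite_range _), next_subset k T⟩
  let v (n : ℕ) : ι → B := next n (S n)
  refine ⟨v, fun n => p_next n (S n), fun t =>
    mem_closure_of_tendsto (tendsto_partialSups _) (Eventually.of_forall fun n => ?_)⟩
  suffices partialSups (fun n => v n (t n)) n ∈ (S (n + 1)).1 from (S (n + 1)).2.2 this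
  induction n with
  | zero => exact mem_sups.2 ⟨⊥, rfl, v 0 (t 0), mem_range_self _, bot_sup_eq _⟩
  | succ n ih =>
    rw [partialSups_add_one]
    exact mem_sups.2 ⟨_, ih, _, mem_range_self (t (n + 1)), rfl⟩

theorem clusterPt_iInf_iSup_of_convergesToZero {b : ℕ → ℕ → B}
    (hb : ∀ n, ConvergesToZero (b n)) :
    ClusterPt (⨅ f : ℕ → ℕ, ⨆ n, b n (f n)) (𝓝 ⊥) := by
  refine (nhds_basis_opens _).clusterPt_iff_forall_mem_closure.2 fun U ⟨hbot, hU⟩ => ?_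
  set e := ⨅ f : ℕ → ℕ, ⨆ n, b n (f n)
  obtain ⟨v, hv, hvU⟩ := exists_forall_iSup_mem_closure (ι := Unit) hU hbot
    (p := fun n v => ∃ k, v = fun _ => b n k ⊓ e) fun n V hV => by
      have h : ConvergesTo (fun k => b n k ⊓ e) ⊥ :=
        convergesTo_bot_iff.2 ((hb n).mono fun _ => inf_le_left)
      obtain ⟨k, hk⟩ := (h.tendsto.eventually_mem hV).exists
      exact ⟨_, fun _ => hk, k, rfl⟩
  choose f hf using hv
  have h := hvU fun _ => ()
  simp only [hf, ← iSup_inf_eq] at h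
  rwa [inf_eq_right.2 (iInf_le _ f)] at h

theorem CCC.exists_diagonal_convergesToZero (hB : CCC B) [T2Space B] {b : ℕ → ℕ → B}
    (hb : ∀ n, ConvergesToZero (b n)) : ∃ f : ℕ → ℕ, ConvergesToZero fun n => b n (f n) := by
  choose c hc hc0 hbc using hb
  have iInf_iSup_eq_bot : ⨅ f : ℕ → ℕ, ⨆ n, c n (f n) = ⊥ :=
    eq_of_nhds_neBot (clusterPt_iInf_iSup_of_convergesToZero fun n =>
      ⟨c n, hc n, hc0 n, fun _ => le_rfl⟩)
  obtain ⟨t, ht⟩ := hB.exists_nat_iInf_eq fun f : ℕ → ℕ => ⨆ n, c n (f n)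
  suffices limsup (fun n => c n (partialSups t n n)) atTop ≤ ⊥ from
    ⟨_, (convergesToZero_iff_limsup.2 (le_bot_iff.1 this)).mono fun n => hbc n _⟩
  rw [← iInf_iSup_eq_bot, ← ht]
  refine le_iInf fun i => limsup_le_of_le (h := ?_)
  filter_upwards [eventually_ge_atTop i] with n hn
  exact (hc n (le_partialSups_of_le t hn n)).trans (le_iSup (fun n => c n (t i n)) n)

theorem CCC.mem_closure_iff_exists_convergesTo (hB : CCC B) [T2Space B] {A : Set B} {x : B} :
    x ∈ closure A ↔ ∃ a : ℕ → B, (∀ n, a n ∈ A) ∧ ConvergesTo a x := by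
  refine ⟨fun hx => ?_, fun ⟨a, ha, hax⟩ =>
    mem_closure_of_tendsto hax.tendsto (Eventually.of_forall ha)⟩
  suffices closure A ⊆ {x | ∃ a : ℕ → B, (∀ n, a n ∈ A) ∧ ConvergesTo a x} from this hx
  refine (isLeast_closure_orderSeqTopology A).2 ⟨fun y hy => ?_, fun y x hy hyx => ?_⟩
  · exact ⟨fun _ => y, fun _ => hy, convergesToZero_bot.mono fun _ => (symmDiff_self y).le⟩
  · choose a ha hay using hy
    obtain ⟨f, hf⟩ := hB.exists_diagonal_convergesToZero hay
    exact ⟨fun n => a n (f n), fun n => ha n (f n),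
      (hf.sup hyx).mono fun n => symmDiff_triangle _ (y n) x⟩

section LowerNeighborhoods

/-- An open neighborhood of `⊥` in `τ_s` that is downward closed. -/
structure IsLowerNhd (U : Set B) : Prop where
  isOpen : IsOpen U
  isLowerSet : IsLowerSet U
  bot_mem : ⊥ ∈ U

theorem IsLowerNhd.mem_nhds {U : Set B} (hU : IsLowerNhd U) : U ∈ 𝓝 ⊥ :=
  hU.isOpen.mem_nhds hU.bot_mem

theorem isUpperSet_closure {A : Set B} (hA : IsUpperSet A) : IsUpperSet (closure A) := by
  intro x y hxy hx
  have mapsTo_sup : MapsTo (· ⊔ y) A A := fun z hz => hA le_sup_left hz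
  simpa only [sup_eq_right.2 hxy] using mapsTo_sup.closure (continuous_sup_const y) hx

theorem CCC.exists_isLowerNhd_subset (hB : CCC B) [T2Space B] {U : Set B} (hU : U ∈ 𝓝 ⊥) :
    ∃ V ⊆ U, IsLowerNhd V := by
  refine ⟨(closure (upperClosure Uᶜ : Set B))ᶜ,
    compl_subset_comm.1 (subset_upperClosure.trans subset_closure),
    isClosed_closure.isOpen_compl, (isUpperSet_closure (upperClosure Uᶜ).upper).compl, fun h => ?_⟩
  obtain ⟨a, ha, ha0⟩ := hB.mem_closure_iff_exists_convergesTo.1 h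
  choose c hc hca using ha
  have tendsto_c : Tendsto c atTop (𝓝 ⊥) :=
    (convergesTo_bot_iff.2 ((convergesTo_bot_iff.1 ha0).mono hca)).tendsto
  obtain ⟨n, hn⟩ := (tendsto_c.eventually_mem hU).exists
  exact hc n hn

theorem IsLowerNhd.sups {U : Set B} (hU : IsLowerNhd U) : IsLowerNhd (U ⊻ U) where
  isOpen := by
    have sups_eq : U ⊻ U = ⋃ u ∈ U, (· ∆ u) ⁻¹' U := by
      ext x
      simp only [mem_sups, mem_iUnion₂, mem_preimage]
      constructor
      · rintro ⟨u, hu, v, hv, rfl⟩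
        refine ⟨u, hu, hU.isLowerSet ?_ hv⟩
        rw [symmDiff_of_ge le_sup_left, sup_sdiff_left_self]
        exact sdiff_le
      · rintro ⟨u, hu, hxu⟩
        exact ⟨x ⊓ u, hU.isLowerSet inf_le_right hu, x \ u,
          hU.isLowerSet le_sup_left hxu, sup_inf_sdiff x u⟩
    rw [sups_eq]
    exact isOpen_biUnion fun u _ => hU.isOpen.preimage (continuous_symmDiff_const u)
  isLowerSet := by
    rintro _ y hy ⟨u, hu, v, hv, rfl⟩
    refine ⟨y ⊓ u, hU.isLowerSet inf_le_right hu, y ⊓ v, hU.isLowerSet inf_le_right hv, ?_⟩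
    exact (inf_sup_left y u v).symm.trans (inf_eq_left.2 hy)
  bot_mem := subset_sups_self hU.bot_mem

theorem IsLowerNhd.closure_subset_sups {U : Set B} (hU : IsLowerNhd U) : closure U ⊆ U ⊻ U := by
  intro x hx
  obtain ⟨z, hzx, hz⟩ := mem_closure_iff.1 hx _
    (hU.isOpen.preimage (continuous_symmDiff_const x))
    (by simpa only [mem_preimage, symmDiff_self] using hU.bot_mem)
  exact hU.sups.isLowerSet (le_symmDiff_sup_left z x) (sup_mem_sups hzx hz)

theorem CCC.exists_nhds_forall_iSup_mem (hB : CCC B) {ι : Type*} [Finite ι] [Nonempty ι]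
    {U O : Set B} (hU : IsOpen U) (hbot : ⊥ ∈ U) (hO : IsOpen O) (hO' : IsLowerSet O)
    (hUO : closure U ⊆ O) : ∃ V ∈ 𝓝 ⊥, ∀ v : ι → B, (∀ i, v i ∈ V) → ⨆ i, v i ∈ O := by
  by_contra! h
  obtain ⟨v, hv, hvU⟩ := exists_forall_iSup_mem_closure (p := fun _ v => ⨆ i, v i ∉ O) hU hbot
    fun _ => h
  obtain ⟨t, φ, -, hφ⟩ := hB.exists_selection v
  set c := ⨆ k, v k (t k)
  have nhds_bot : (· ⊔ c) ⁻¹' O ∈ 𝓝 ⊥ := (hO.preimage (continuous_sup_const c)).mem_nhds (by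
    simpa only [mem_preimage, bot_sup_eq] using hUO (hvU t))
  obtain ⟨n, hn⟩ := ((convergesTo_bot_iff.2 hφ).tendsto.eventually_mem nhds_bot).exists
  exact hv (φ n) (hO' le_sdiff_sup hn)

theorem CCC.exists_isLowerNhd_sups_sups_subset (hB : CCC B) [T2Space B] {U : Set B}
    (hU : IsLowerNhd U) : ∃ V, IsLowerNhd V ∧ (V ⊻ V) ⊻ (V ⊻ V) ⊆ U ⊻ U := by
  obtain ⟨N, hN, hNU⟩ := hB.exists_nhds_forall_iSup_mem (ι := Fin 4) hU.isOpen hU.bot_mem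
    hU.sups.isOpen hU.sups.isLowerSet hU.closure_subset_sups
  obtain ⟨V, hVN, hV⟩ := hB.exists_isLowerNhd_subset hN
  refine ⟨V, hV, ?_⟩
  simp only [sups_subset_iff, forall_sups_iff]
  intro x hx y hy z hz w hw
  let v : Fin 4 → B := ![x, y, z, w]
  have hv : ⨆ i, v i ∈ U ⊻ U := hNU v fun i => hVN (by fin_cases i <;> assumption)
  exact hU.sups.isLowerSet
    (sup_le (sup_le (le_iSup v 0) (le_iSup v 1)) (sup_le (le_iSup v 2) (le_iSup v 3))) hv

end LowerNeighborhoods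

section NeighborhoodChains

/-- A sequence of lower neighborhoods of `⊥`, each containing the joins of any two elements of the
next one: the neighborhoods of `⊥` that will generate the uniformity of a Maharam submeasure. -/
structure IsNhdChain (W : ℕ → Set B) : Prop where
  isLowerNhd (n : ℕ) : IsLowerNhd (W n)
  sups_subset (n : ℕ) : W (n + 1) ⊻ W (n + 1) ⊆ W n

theorem IsNhdChain.antitone {W : ℕ → Set B} (hW : IsNhdChain W) : Antitone W :=
  antitone_nat_of_succ_le fun n => subset_sups_self.trans (hW.sups_subset n)

theorem IsNhdChain.isClosed_iInter {W : ℕ → Set B} (hW : IsNhdChain W) :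
    IsClosed (⋂ n, W n) := by
  refine isClosed_of_closure_subset (subset_iInter fun n => ?_)
  calc closure (⋂ n, W n) ⊆ closure (W (n + 1)) := closure_mono (iInter_subset W (n + 1))
    _ ⊆ W (n + 1) ⊻ W (n + 1) := (hW.isLowerNhd (n + 1)).closure_subset_sups
    _ ⊆ W n := hW.sups_subset n

theorem IsNhdChain.supClosed_iInter {W : ℕ → Set B} (hW : IsNhdChain W) :
    SupClosed (⋂ n, W n) := fun _ hx _ hy => mem_iInter.2 fun n =>
  hW.sups_subset n (sup_mem_sups (mem_iInter.1 hx (n + 1)) (mem_iInter.1 hy (n + 1)))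

theorem CCC.sSup_iInter_mem_iInter (hB : CCC B) {W : ℕ → Set B} (hW : IsNhdChain W) :
    sSup (⋂ n, W n) ∈ ⋂ n, W n :=
  hB.sSup_mem_of_isClosed hW.isClosed_iInter
    ⟨⊥, mem_iInter.2 fun n => (hW.isLowerNhd n).bot_mem⟩ hW.supClosed_iInter

theorem isNhdChain_univ : IsNhdChain fun _ => (univ : Set B) :=
  ⟨fun _ => ⟨isOpen_univ, isLowerSet_univ, mem_univ ⊥⟩, fun _ => subset_univ _⟩

theorem isNhdChain_biInter {W : ℕ → ℕ → Set B} (hW : ∀ k, IsNhdChain (W k)) :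
    IsNhdChain fun n => ⋂ k ≤ n, W k n where
  isLowerNhd n :=
    { isOpen := (finite_Iic n).isOpen_biInter fun k _ => ((hW k).isLowerNhd n).isOpen
      isLowerSet := isLowerSet_iInter₂ fun k _ => ((hW k).isLowerNhd n).isLowerSet
      bot_mem := mem_iInter₂.2 fun k _ => ((hW k).isLowerNhd n).bot_mem }
  sups_subset n := sups_subset_iff.2 fun _ hx _ hy => mem_iInter₂.2 fun k hk =>
    (hW k).sups_subset n (sup_mem_sups (mem_iInter₂.1 hx k (hk.trans n.le_succ))
      (mem_iInter₂.1 hy k (hk.trans n.le_succ)))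

theorem CCC.exists_isLowerNhd_notMem_sups (hB : CCC B) [T2Space B] {a : B} (ha : a ≠ ⊥) :
    ∃ V, IsLowerNhd V ∧ a ∉ V ⊻ V := by
  obtain ⟨O, U, hO, hU, haO, hbot, hOU⟩ := t2_separation ha
  have nhds_bot : U ∩ (· ∆ a) ⁻¹' O ∈ 𝓝 ⊥ :=
    inter_mem (hU.mem_nhds hbot) ((hO.preimage (continuous_symmDiff_const a)).mem_nhds (by
      simpa only [mem_preimage, bot_symmDiff] using haO))
  obtain ⟨V, hVsub, hV⟩ := hB.exists_isLowerNhd_subset nhds_bot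
  refine ⟨V, hV, ?_⟩
  rintro ⟨x, hx, y, hy, rfl⟩
  have sdiff_mem : y \ x ∈ V := hV.isLowerSet sdiff_le hy
  have symmDiff_le : (y \ x) ∆ (x ⊔ y) ≤ x := by
    rw [symmDiff_of_le (sdiff_le.trans le_sup_right), sdiff_le_iff, sdiff_sup_self, sup_comm]
  exact hOU.notMem_of_mem_left (hVsub sdiff_mem).2 (hVsub (hV.isLowerSet symmDiff_le hx)).1

theorem CCC.exists_isNhdChain_notMem (hB : CCC B) [T2Space B] {a : B} (ha : a ≠ ⊥) :
    ∃ W, IsNhdChain W ∧ a ∉ W 0 := by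
  obtain ⟨V, hV, haV⟩ := hB.exists_isLowerNhd_notMem_sups ha
  choose next isLowerNhd_next sups_next using fun U : {U : Set B // IsLowerNhd U} =>
    hB.exists_isLowerNhd_sups_sups_subset U.2
  let S (n : ℕ) : {U : Set B // IsLowerNhd U} :=
    n.rec ⟨V, hV⟩ fun _ U => ⟨next U, isLowerNhd_next U⟩
  exact ⟨fun n => (S n).1 ⊻ (S n).1, ⟨fun n => (S n).2.sups, fun n => sups_next (S n)⟩, haV⟩

theorem CCC.exists_isNhdChain_iInter_eq_singleton (hB : CCC B) [T2Space B] :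
    ∃ W : ℕ → Set B, IsNhdChain W ∧ ⋂ n, W n = {⊥} := by
  let Chain := {W : ℕ → Set B // IsNhdChain W}
  have : Nonempty Chain := ⟨⟨_, isNhdChain_univ⟩⟩
  have iInf_eq_bot : ⨅ W : Chain, sSup (⋂ n, W.1 n) = ⊥ := by
    by_contra ha
    obtain ⟨W, hW, haW⟩ := hB.exists_isNhdChain_notMem ha
    exact haW ((hW.isLowerNhd 0).isLowerSet (iInf_le (fun W : Chain => sSup (⋂ n, W.1 n)) ⟨W, hW⟩)
      (mem_iInter.1 (hB.sSup_iInter_mem_iInter hW) 0))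
  obtain ⟨t, ht⟩ := hB.exists_nat_iInf_eq fun W : Chain => sSup (⋂ n, W.1 n)
  have chain := isNhdChain_biInter fun k => (t k).2
  refine ⟨_, chain, subset_antisymm (fun x hx => ?_)
    (singleton_subset_iff.2 (mem_iInter.2 fun n => (chain.isLowerNhd n).bot_mem))⟩
  have x_mem (k n : ℕ) : x ∈ (t k).1 n := (t k).2.antitone (le_max_right k n)
    (mem_iInter₂.1 (mem_iInter.1 hx (max k n)) k (le_max_left k n))
  rw [mem_singleton_iff, ← le_bot_iff, ← iInf_eq_bot, ← ht]
  exact le_iInf fun k => le_sSup (mem_iInter.2 (x_mem k))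

end NeighborhoodChains

theorem IsNhdChain.exists_isMaharamSubmeasure {W : ℕ → Set B} (hW : IsNhdChain W) :
    ∃ μ : B → ℝ, IsMaharamSubmeasure μ ∧ ∀ x, μ x = 0 → x ∈ ⋂ n, W n := by
  obtain ⟨_, hbasis⟩ := exists_pseudoMetricSpace_hasBasis_uniformity
    (E := fun n => {p : B × B | p.1 ∆ p.2 ∈ W n})
    (fun n x => by simpa only [mem_ofPred_eq, symmDiff_self] using (hW.isLowerNhd n).bot_mem)
    (fun n x y => by simp only [mem_ofPred_eq, symmDiff_comm, imp_self])
    (fun n x y z hxy hyz => (hW.isLowerNhd n).isLowerSet (symmDiff_triangle x y z)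
      (hW.sups_subset n (sup_mem_sups hxy hyz)))
  refine ⟨_, isMaharamSubmeasure_toReal_min_one displacement_bot displacement_mono
    displacement_sup_le fun a ha ha0 => ?_, fun x hx => mem_iInter.2 fun n => ?_⟩
  · refine ENNReal.tendsto_nhds_zero.2 fun ε hε => ?_
    obtain ⟨n, -, hn⟩ := hbasis.mem_iff.1 (edist_mem_uniformity hε)
    have tendsto_a : ConvergesTo a ⊥ := convergesTo_bot_iff.2 ⟨a, ha, ha0, fun _ => le_rfl⟩
    filter_upwards [tendsto_a.tendsto.eventually_mem (hW.isLowerNhd n).mem_nhds] with k hk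
    refine displacement_le_iff.2 fun y z hz => le_of_lt (@hn (y, y ∆ z) ?_)
    simpa only [mem_ofPred_eq, symmDiff_symmDiff_cancel_left] using
      (hW.isLowerNhd n).isLowerSet hz hk
  · have edist_eq_zero : edist ⊥ x = 0 := by
      have h : displacement x = 0 := by simpa [ENNReal.toReal_eq_zero_iff] using hx
      exact le_bot_iff.1 ((edist_bot_le_displacement x).trans_eq h)
    obtain ⟨ε, hε, hεW⟩ := mem_uniformity_edist.1 (hbasis.mem_of_mem (i := n) trivial)
    simpa only [mem_ofPred_eq, bot_symmDiff] using hεW (edist_eq_zero.trans_lt hε)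

theorem CCC.carriesStrictlyPositiveMaharam (hB : CCC B) [T2Space B] :
    CarriesStrictlyPositiveMaharam B := by
  obtain ⟨W, hW, hW_eq⟩ := hB.exists_isNhdChain_iInter_eq_singleton
  obtain ⟨μ, hμ, hμW⟩ := hW.exists_isMaharamSubmeasure
  exact ⟨μ, hμ, fun x hx => mem_singleton_iff.1 (hW_eq ▸ hμW x hx)⟩

section RelativeAlgebra

theorem CCC.relative (hB : CCC B) (a : B) : CCC (Iic a) := fun A hne hdisj => by
  refine countable_of_injective_of_countable_image (f := Subtype.val)
    Subtype.val_injective.injOn (hB _ ?_ ?_)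
  · rintro _ ⟨x, hx, rfl⟩ h
    exact hne x hx (Subtype.ext h)
  · rintro _ ⟨x, hx, rfl⟩ _ ⟨y, hy, rfl⟩ hxy
    exact congrArg Subtype.val (hdisj x hx y hy fun h => hxy (congrArg _ h))

/-- The projection `x ↦ x ⊓ a` of `B` onto the relative algebra `B ↾ a`. -/
def toRelative (a x : B) : Iic a :=
  ⟨x ⊓ a, inf_le_right⟩

theorem toRelative_self (a : B) : toRelative a a = ⊤ :=
  Subtype.ext (inf_idem a)

theorem toRelative_bot (a : B) : toRelative a ⊥ = ⊥ :=
  Subtype.ext (bot_inf_eq a)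

theorem toRelative_mono (a : B) : Monotone (toRelative a) := fun _ _ h =>
  inf_le_inf_right a h

theorem toRelative_sup (a x y : B) : toRelative a (x ⊔ y) = toRelative a x ⊔ toRelative a y :=
  Subtype.ext (inf_sup_right x y a)

theorem toRelative_symmDiff (a x y : B) :
    toRelative a (x ∆ y) = toRelative a x ∆ toRelative a y :=
  Subtype.ext (inf_symmDiff_distrib_right x y a)

theorem toRelative_iInf (a : B) (b : ℕ → B) : toRelative a (⨅ n, b n) = ⨅ n, toRelative a (b n) :=
  Subtype.ext <| by
    rw [Iic.coe_iInf]
    simp only [toRelative, ← iInf_inf, inf_comm a, inf_assoc, inf_idem]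

theorem continuous_toRelative (a : B) :
    Continuous[orderSeqTopology B, orderSeqTopology (Iic a)] (toRelative a) :=
  continuous_of_convergesTo fun u x ⟨b, hb, hb0, hub⟩ =>
    ⟨fun n => toRelative a (b n), (toRelative_mono a).comp_antitone hb,
      by rw [← toRelative_iInf, hb0, toRelative_bot],
      fun n => (toRelative_symmDiff a (u n) x).symm.trans_le (toRelative_mono a (hub n))⟩

theorem continuous_coe_relative (a : B) :
    Continuous[orderSeqTopology (Iic a), orderSeqTopology B] Subtype.val :=
  continuous_of_convergesTo fun _ _ ⟨b, hb, hb0, hub⟩ =>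
    have iInf_le_a : ⨅ n, (b n : B) ≤ a := (iInf_le _ 0).trans (b 0).2
    ⟨fun n => b n, fun _ _ h => hb h,
      by rw [← inf_eq_right.2 iInf_le_a, ← Iic.coe_iInf, hb0, Iic.coe_bot], hub⟩

theorem IsMaharamSubmeasure.comp_toRelative {a : B} {μ : Iic a → ℝ} (hμ : IsMaharamSubmeasure μ) :
    IsMaharamSubmeasure (μ ∘ toRelative a) where
  nonneg _ := hμ.nonneg _
  map_bot := by rw [Function.comp_apply, toRelative_bot, hμ.map_bot]
  mono _ _ h := hμ.mono _ _ (toRelative_mono a h)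
  map_sup_le x y := by
    simpa only [Function.comp_apply, toRelative_sup] using hμ.map_sup_le _ _
  continuous u hu hu0 := hμ.continuous _ ((toRelative_mono a).comp_antitone hu) <| by
    simp only [← toRelative_iInf, hu0, toRelative_bot]

theorem CarriesStrictlyPositiveMaharam.exists_isMaharamSubmeasure_ne_zero {a : B} (ha : a ≠ ⊥)
    (h : CarriesStrictlyPositiveMaharam (Iic a)) :
    ∃ μ : B → ℝ, IsMaharamSubmeasure μ ∧ ∃ x, μ x ≠ 0 := by
  obtain ⟨μ, hμ, hpos⟩ := h
  refine ⟨_, hμ.comp_toRelative, a, fun hμa => ha ?_⟩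
  rw [Function.comp_apply, toRelative_self] at hμa
  exact congrArg Subtype.val (hpos ⊤ hμa)

theorem CCC.everyNonemptyOpenDense_densePart (hB : CCC B) :
    EveryNonemptyOpenDense (Iic (densePart B)) := by
  refine everyNonemptyOpenDense_of_clusterPt_top ?_
  simpa only [toRelative_self, toRelative_bot] using
    clusterPt_nhds_map (continuous_toRelative (densePart B)) hB.clusterPt_densePart

theorem t2Space_relative_compl_densePart : @T2Space (Iic (densePart B)ᶜ) (orderSeqTopology _) := by
  refine t2Space_of_forall_clusterPt fun x hx => ?_
  have hx' : ClusterPt (x : B) (𝓝 ⊥) := clusterPt_nhds_map (continuous_coe_relative _) hx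
  exact Subtype.ext (disjoint_self.1 (disjoint_compl_right.mono (le_sSup hx') x.2))

theorem CCC.carriesStrictlyPositiveMaharam_compl_densePart (hB : CCC B) :
    CarriesStrictlyPositiveMaharam (Iic (densePart B)ᶜ) :=
  have := t2Space_relative_compl_densePart (B := B)
  (hB.relative _).carriesStrictlyPositiveMaharam

end RelativeAlgebra

end Topology

end BoolSeq

open BoolSeq in
/-- Decomposition of a complete ccc Boolean algebra, and the resulting dichotomy. -/
theorem mainTheorem1 (B : Type*) [CompleteBooleanAlgebra B] (hB : BoolSeq.CCC B) :
    (∃ d m : B, d ⊓ m = ⊥ ∧ d ⊔ m = ⊤ ∧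
      BoolSeq.EveryNonemptyOpenDense (Set.Iic d) ∧
      BoolSeq.CarriesStrictlyPositiveMaharam (Set.Iic m)) ∧
    (((∃ a : B, a ≠ ⊥ ∧ BoolSeq.CarriesStrictlyPositiveMaharam (Set.Iic a)) ∧
        (∃ μ : B → ℝ, BoolSeq.IsMaharamSubmeasure μ ∧ ∃ x, μ x ≠ 0)) ∨
      BoolSeq.EveryNonemptyOpenDense B) := by
  have dense := hB.everyNonemptyOpenDense_densePart
  have maharam := hB.carriesStrictlyPositiveMaharam_compl_densePart
  refine ⟨⟨densePart B, (densePart B)ᶜ, inf_compl_self _, sup_compl_eq_top, dense, maharam⟩, ?_⟩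
  by_cases h : densePart B = ⊤
  · exact .inr (everyNonemptyOpenDense_of_clusterPt_top (h ▸ hB.clusterPt_densePart))
  · have compl_ne : (densePart B)ᶜ ≠ ⊥ := mt compl_eq_bot.1 h
    exact .inl ⟨⟨_, compl_ne, maharam⟩, maharam.exists_isMaharamSubmeasure_ne_zero compl_ne⟩
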